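/- For a finite graph $G$ let $\tau(G)$ denote the number of spanning trees of $G$. For a positive integer $n$, let $L(n,n)$ be the $n\times n$ square lattice, that is, the Cartesian product of two copies of the path graph with $n$ vertices, and let $\mathrm{QAD}_n$ be the quartered Aztec diamond of order (side length) $n$, that is, the subgraph of $\mathbb{Z}^2$ (nearest neighbours connected) induced by the vertices $(k_1,k_2)$ with $k_1,k_2\geqslant 0$ and $k_1+k_2\leqslant n-1$, so that each leg of the triangle has $n$ vertices. Then, for every integer $n\geqslant 1$, $$\tau(\mathrm{QAD}_n)=\frac{\tau(L(n,n))^{1/2}}{\sqrt{n}\,2^{(n-1)/2}}.$$ -/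

import Mathlib

/-- The number of spanning trees of `G`: a spanning tree is a subgraph of `G` on the same vertex
set that is a tree. -/
noncomputable def numSpanningTrees {V : Type*} (G : SimpleGraph V) : ℕ :=
  Set.ncard {T : SimpleGraph V | T ≤ G ∧ T.IsTree}

/-- The rectangular square lattice `L(n₁, n₂)`: the Cartesian product of the path graphs on
`n₁` and `n₂` vertices. -/
def rectLattice (n₁ n₂ : ℕ) : SimpleGraph (Fin n₁ × Fin n₂) :=
  SimpleGraph.boxProd (SimpleGraph.pathGraph n₁) (SimpleGraph.pathGraph n₂)

/-- The infinite square lattice `ℤ²` with nearest neighbours connected. -/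
def squareGrid : SimpleGraph (ℤ × ℤ) where
  Adj k l := |k.1 - l.1| + |k.2 - l.2| = 1
  symm := ⟨fun k l h => by rwa [abs_sub_comm l.1, abs_sub_comm l.2]⟩
  loopless := ⟨fun k h => by simp at h⟩

/-- The vertices of the quartered Aztec diamond of side length `n`: there are `n` of them along
each of the two legs of the triangle. -/
def qadVertices (n : ℕ) : Set (ℤ × ℤ) :=
  {k | 0 ≤ k.1 ∧ 0 ≤ k.2 ∧ k.1 + k.2 ≤ (n : ℤ) - 1}

/-- The quartered Aztec diamond of order (side length) `n`, an induced subgraph of `ℤ²`. -/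
def quarteredAztecDiamond (n : ℕ) : SimpleGraph (qadVertices n) :=
  squareGrid.induce (qadVertices n)

/-!
The identity is equivalent to `τ(L(n, n)) = 2 ^ (n - 1) * n * τ(QAD_n) ^ 2`. Both graphs are
induced on a finite lower set of `ℕ × ℕ`, and for such a graph the number of spanning trees is the
determinant of the Dirichlet Laplacian on the unit squares inside it
(`numSpanningTrees_latticeGraph`).

To see this, the matrix-tree theorem (`numSpanningTrees_eq_det`) writes the number of spanning
trees as the determinant of the reduced Laplacian, the Gram matrix of the reduced incidence matrix
`(B₁ B₂)`. It is proved by expanding the determinant in the rows: the nonzero terms correspond to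
the functions that send each vertex to its parent in a spanning tree. The boundaries of the faces
form a matrix `(C₁ C₂)` whose rows are orthogonal to those of the incidence matrix and whose Gram
matrix is the Dirichlet Laplacian on the faces. With respect to the comb, the spanning tree of all
vertical edges and the bottom row, the blocks `B₁` (tree edges) and `C₂` (other edges) are
unimodular, so the two Gram determinants agree (`det_gram_eq_det_gram_of_orthogonal`).

The faces of `L(n, n)` form a square of side `n - 1`, and the Dirichlet Laplacian on them is the
Kronecker sum `P ⊗ 1 + 1 ⊗ P`, where `P` is the Dirichlet Laplacian of the path on `n - 1`
vertices. The faces of `QAD_n`, after a reflection, are those strictly above the diagonal of this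
square, and their Dirichlet Laplacian is the antisymmetric part of the Kronecker sum. If `P` has
the eigenvalues `μ j`, the Kronecker sum has determinant `∏_{j, k} (μ j + μ k)` and its
antisymmetric part `∏_{j < k} (μ j + μ k)` (`det_kroneckerSum`). The diagonal factors contribute
`2 ^ (n - 1) * det P`, and `det P = n` (`det_pathDirichlet`).
-/

open Matrix Finset
open scoped Kronecker

/-! ### Matrices of partial functions -/

/-- The matrix of a partial function `g`: the row of `x` is the indicator of `g x`, and it
vanishes if `g x` is undefined. -/
def partialFunMatrix {X : Type*} [DecidableEq X] (g : X → Option X) : Matrix X X ℝ :=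
  Matrix.of fun x y => if g x = some y then 1 else 0

section PartialFun

variable {X : Type*} [Fintype X] [DecidableEq X]

theorem partialFunMatrix_mulVec (g : X → Option X) (φ : X → ℝ) (x : X) :
    (partialFunMatrix g *ᵥ φ) x = (g x).elim 0 φ := by
  cases h : g x with
  | none => simp [partialFunMatrix, mulVec, dotProduct, h]
  | some y => simp [partialFunMatrix, mulVec, dotProduct, h]

/-- If every orbit of `g` ends, a permutation that follows `g` at all points it moves is the
identity, so only the identity contributes to the Leibniz expansion. -/
theorem det_one_sub_partialFunMatrix (g : X → Option X)
    (hg : WellFounded fun y x => g x = some y) : (1 - partialFunMatrix g).det = 1 := by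
  have hne : ∀ x, g x ≠ some x := fun x hx => hg.irrefl.irrefl x hx
  rw [← det_transpose, det_apply, Finset.sum_eq_single 1]
  · simp [partialFunMatrix, hne]
  · intro σ _ hσ
    have hex : ∃ x, x ∈ {x | σ x ≠ x} := by
      by_contra! h
      exact hσ (Equiv.ext fun x => by simpa using h x)
    have hmin := hg.min_mem _ hex
    have hlt := fun y hy => hg.not_lt_min {x | σ x ≠ x} (x := y) hy
    set x := hg.min _ hex with hx
    rw [Finset.prod_eq_zero (Finset.mem_univ x), smul_zero]
    have h1 : g x ≠ some (σ x) := fun h => hlt (σ x) (by simpa using hmin) h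
    have h2 : x ≠ σ x := fun h => hmin h.symm
    simp [partialFunMatrix, h1, h2]
  · simp

/-- The indicator of the set of points whose orbit under `g` does not end is in the kernel. -/
theorem det_one_sub_partialFunMatrix_eq_zero (g : X → Option X)
    (hg : ¬ WellFounded fun y x => g x = some y) : (1 - partialFunMatrix g).det = 0 := by
  classical
  refine exists_mulVec_eq_zero_iff.mp
    ⟨fun x => if Acc (fun y x => g x = some y) x then 0 else 1, ?_, ?_⟩
  · intro h
    exact hg ⟨fun x => by simpa using congrFun h x⟩
  · ext x
    rw [sub_mulVec, one_mulVec, Pi.sub_apply, partialFunMatrix_mulVec, Pi.zero_apply, sub_eq_zero]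
    cases h : g x with
    | none =>
      have : Acc (fun y x => g x = some y) x := ⟨_, fun y hy => by simp [h] at hy⟩
      simp [this]
    | some y =>
      have : Acc (fun y x => g x = some y) x ↔ Acc (fun y x => g x = some y) y :=
        ⟨fun hx => hx.inv h, fun hy => ⟨_, fun z hz => by
          rw [h, Option.some.injEq] at hz; exact hz ▸ hy⟩⟩
      simp [this]

end PartialFun

/-! ### The matrix-tree theorem -/

section MatrixTree

variable {V : Type*} {r : V}

/-- The partial function on the vertices other than `r` induced by `p`: it is undefined where
`p` takes the value `r`. -/
noncomputable def restrictParent (p : {v // v ≠ r} → V) (v : {v // v ≠ r}) : Option {v // v ≠ r} :=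
  open Classical in if h : p v ≠ r then some ⟨p v, h⟩ else none

theorem restrictParent_eq_some (p : {v // v ≠ r} → V) (v w : {v // v ≠ r}) :
    restrictParent p v = some w ↔ p v = w := by
  unfold restrictParent
  split_ifs with h
  · simp [Subtype.ext_iff]
  · simp only [ne_eq, not_not] at h
    simpa [h] using fun hw => w.2 hw.symm

/-- `p` is a parent function for the root `r` if following `p` from any vertex ends at `r`. -/
def IsParentFun (p : {v // v ≠ r} → V) : Prop :=
  WellFounded fun y x : {v // v ≠ r} => p x = y

theorem IsParentFun.ne {p : {v // v ≠ r} → V} (hp : IsParentFun p) (v : {v // v ≠ r}) :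
    p v ≠ v :=
  fun h => hp.irrefl.irrefl v h

/-- The graph whose edges join each vertex other than `r` to its parent. -/
def parentGraph (p : {v // v ≠ r} → V) : SimpleGraph V :=
  SimpleGraph.fromRel fun u v => ∃ h : u ≠ r, p ⟨u, h⟩ = v

theorem IsParentFun.adj {p : {v // v ≠ r} → V} (hp : IsParentFun p) (v : {v // v ≠ r}) :
    (parentGraph p).Adj v (p v) := by
  simp only [parentGraph, SimpleGraph.fromRel_adj]
  exact ⟨(hp.ne v).symm, Or.inl ⟨v.2, trivial⟩⟩

theorem IsParentFun.connected {p : {v // v ≠ r} → V} (hp : IsParentFun p) :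
    (parentGraph p).Connected := by
  have h : ∀ v : {v // v ≠ r}, (parentGraph p).Reachable v r := by
    intro v
    induction v using hp.induction with
    | _ v ih =>
      refine (hp.adj v).reachable.trans ?_
      by_cases hr : p v = r
      · rw [hr]
      · exact ih ⟨p v, hr⟩ rfl
  have h' : ∀ v, (parentGraph p).Reachable v r := fun v => by
    by_cases hv : v = r
    · rw [hv]
    · exact h ⟨v, hv⟩
  exact { preconnected := fun u v => (h' u).trans (h' v).symm, nonempty := ⟨r⟩ }

theorem IsParentFun.isTree [Finite V] {p : {v // v ≠ r} → V} (hp : IsParentFun p) :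
    (parentGraph p).IsTree := by
  have : Fintype V := Fintype.ofFinite V
  classical
  refine SimpleGraph.isTree_iff_connected_and_card.mpr ⟨hp.connected, le_antisymm ?_
    hp.connected.card_vert_le_card_edgeSet_add_one⟩
  have hsub : (parentGraph p).edgeSet ⊆ Set.range fun v : {v // v ≠ r} => s((v : V), p v) := by
    intro e
    induction e with
    | _ u v =>
      simp only [SimpleGraph.mem_edgeSet, parentGraph, SimpleGraph.fromRel_adj]
      rintro ⟨-, ⟨h, h'⟩ | ⟨h, h'⟩⟩
      · exact ⟨⟨u, h⟩, by simp [h']⟩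
      · exact ⟨⟨v, h⟩, by simp [h', Sym2.eq_swap]⟩
  have h1 := Set.ncard_le_ncard hsub (Set.toFinite _)
  have h2 : (Set.range fun v : {v // v ≠ r} => s((v : V), p v)).ncard ≤ Nat.card {v // v ≠ r} := by
    rw [← Set.image_univ, ← Set.ncard_univ]
    exact Set.ncard_image_le (Set.toFinite _)
  have h3 : Nat.card {v // v ≠ r} + 1 = Nat.card V := by
    rw [Nat.card_eq_fintype_card, Nat.card_eq_fintype_card, Fintype.card_subtype_compl,
      Fintype.card_subtype_eq]
    have : 0 < Fintype.card V := Fintype.card_pos_iff.mpr ⟨r⟩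
    omega
  have h4 := Nat.card_coe_set_eq (parentGraph p).edgeSet
  omega

theorem parentGraph_le {p : {v // v ≠ r} → V} {G : SimpleGraph V}
    (h : ∀ v : {v // v ≠ r}, G.Adj v (p v)) : parentGraph p ≤ G := by
  intro u v
  simp only [parentGraph, SimpleGraph.fromRel_adj]
  rintro ⟨-, ⟨h1, h2⟩ | ⟨h1, h2⟩⟩
  · exact h2 ▸ h ⟨u, h1⟩
  · exact (h2 ▸ h ⟨v, h1⟩).symm

/-- If two parent functions with the same graph differ at `v`, they differ at the parent of `v`
as well, and the root is never reached. -/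
theorem parentGraph_injOn : Set.InjOn parentGraph {p : {v // v ≠ r} → V | IsParentFun p} := by
  intro p hp q hq hpq
  have key : ∀ v : {v // v ≠ r}, p v = q v := by
    intro v
    induction v using hp.induction with
    | _ v ih =>
      by_contra hne
      have hadj : (parentGraph q).Adj v (p v) := hpq ▸ hp.adj v
      simp only [parentGraph, SimpleGraph.fromRel_adj] at hadj
      obtain ⟨-, ⟨h1, h2⟩ | ⟨h1, h2⟩⟩ := hadj
      · exact hne h2.symm
      · have h3 : p ⟨p v, h1⟩ = v := (ih ⟨p v, h1⟩ rfl).trans h2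
        exact hp.asymm.asymm v ⟨p v, h1⟩ h3 rfl
  exact funext key

/-- In a tree, the parent of a vertex is a neighbour that is closer to the root. -/
theorem exists_parentGraph_eq [Finite V] {T : SimpleGraph V} (hT : T.IsTree) (r : V) :
    ∃ p : {v // v ≠ r} → V, IsParentFun p ∧ parentGraph p = T := by
  have hstep : ∀ v : {v // v ≠ r}, ∃ u, T.Adj v u ∧ T.dist u r < T.dist v r := by
    rintro ⟨v, hv⟩
    obtain ⟨w, hw⟩ := hT.connected.exists_walk_length_eq_dist v r
    cases w with
    | nil => exact absurd rfl hv
    | cons h q =>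
      refine ⟨_, h, ?_⟩
      have := SimpleGraph.dist_le q
      simp only [SimpleGraph.Walk.length_cons] at hw
      simp only
      omega
  choose p hadj hlt using hstep
  have hp : IsParentFun p := by
    refine Subrelation.wf ?_ (InvImage.wf (fun v : {v // v ≠ r} => T.dist v r) wellFounded_lt)
    intro y x hxy
    have h1 := hlt x
    rw [hxy] at h1
    exact h1
  refine ⟨p, hp, ?_⟩
  have hle := parentGraph_le hadj
  exact le_antisymm hle
    ((SimpleGraph.isTree_iff_minimal_connected.mp hT).le_of_le hp.connected hle)

/-- Spanning trees correspond to parent functions. -/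
theorem numSpanningTrees_eq_ncard_parentFun [Finite V] (G : SimpleGraph V) (r : V) :
    numSpanningTrees G =
      Set.ncard {p : {v // v ≠ r} → V | (∀ v : {v // v ≠ r}, G.Adj v (p v)) ∧ IsParentFun p} := by
  rw [numSpanningTrees, ← (parentGraph_injOn.mono fun p hp => hp.2).ncard_image]
  congr 1
  ext T
  constructor
  · rintro ⟨hTG, hT⟩
    obtain ⟨p, hp, rfl⟩ := exists_parentGraph_eq hT r
    exact ⟨p, ⟨fun v => hTG (hp.adj v), hp⟩, rfl⟩
  · rintro ⟨p, ⟨h1, h2⟩, rfl⟩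
    exact ⟨parentGraph_le h1, h2.isTree⟩

/-- The Laplacian of `G` without the row and the column of the root `r`. The row of `v` is
written as the sum of the vectors `e_v - e_u` over the neighbours `u` of `v`. -/
noncomputable def reducedLaplacian [Fintype V] [DecidableEq V] (G : SimpleGraph V) (r : V) :
    Matrix {v // v ≠ r} {v // v ≠ r} ℝ :=
  open Classical in Matrix.of fun v w =>
    ∑ u, if G.Adj v u then (if v = w then 1 else 0) - (if u = w then 1 else 0) else 0

/-- The **matrix-tree theorem**. Expanding the determinant by multilinearity in the rows gives a
sum over the functions `p` that choose a neighbour of each vertex other than `r`, in which the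
term of `p` is `1` if `p` is a parent function and `0` if not. -/
theorem numSpanningTrees_eq_det [Fintype V] [DecidableEq V] (G : SimpleGraph V) (r : V) :
    (numSpanningTrees G : ℝ) = (reducedLaplacian G r).det := by
  classical
  have hrow : reducedLaplacian G r = fun v : {v // v ≠ r} => ∑ u ∈ Finset.univ.filter (G.Adj v),
      fun w : {v // v ≠ r} => (if v = w then (1 : ℝ) else 0) - (if u = w then 1 else 0) := by
    ext v w
    rw [Finset.sum_apply, Finset.sum_filter]
    rfl
  have hdet : ∀ p : {v // v ≠ r} → V,
      detRowAlternating (R := ℝ) (fun (v w : {v // v ≠ r}) =>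
        (if v = w then (1 : ℝ) else 0) - (if p v = w then 1 else 0)) =
      if IsParentFun p then 1 else 0 := by
    intro p
    -- the matrix with rows `e_v - e_{p v}` is that of a partial function
    have h1 : (fun (v w : {v // v ≠ r}) =>
        (if v = w then (1 : ℝ) else 0) - (if p v = w then 1 else 0)) =
        (1 - partialFunMatrix (restrictParent p) : Matrix {v // v ≠ r} {v // v ≠ r} ℝ) := by
      ext v w
      simp [partialFunMatrix, restrictParent_eq_some, Matrix.one_apply]
    have h2 : IsParentFun p ↔ WellFounded fun y x => restrictParent p x = some y := by
      simp only [IsParentFun, restrictParent_eq_some]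
    rw [h1]
    split_ifs with h
    · exact det_one_sub_partialFunMatrix _ (h2.mp h)
    · exact det_one_sub_partialFunMatrix_eq_zero _ (h2.not.mp h)
  rw [hrow]
  change _ = (detRowAlternating (R := ℝ) (n := {v // v ≠ r})).toMultilinearMap _
  rw [MultilinearMap.map_sum_finset]
  simp only [AlternatingMap.coe_multilinearMap, hdet]
  rw [← Finset.sum_filter, Finset.sum_const, nsmul_eq_mul, mul_one,
    numSpanningTrees_eq_ncard_parentFun G r, ← Set.ncard_coe_finset]
  congr 2
  ext p
  simp

end MatrixTree

/-! ### The Laplacian as a Gram matrix and cycle-space duality -/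

/-- `s` and `t` enumerate the edges of `G`, each exactly once and with one orientation, by their
sources and targets. -/
structure IsEdgeEnumeration {V E : Type*} (G : SimpleGraph V) (s t : E → V) : Prop where
  adj_source_target : ∀ e, G.Adj (s e) (t e)
  exists_of_adj : ∀ u v, G.Adj u v → ∃ e, (s e = u ∧ t e = v) ∨ (s e = v ∧ t e = u)
  injective : ∀ e e', s e = s e' → t e = t e' → e = e'
  oriented : ∀ e e', s e = t e' → t e = s e' → False

theorem IsEdgeEnumeration.sum_darts {V E : Type*} [Fintype V] [DecidableEq V] [Fintype E]
    {G : SimpleGraph V} [DecidableRel G.Adj] {s t : E → V} (h : IsEdgeEnumeration G s t)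
    (φ : V → V → ℝ) :
    ∑ e, (φ (s e) (t e) + φ (t e) (s e)) = ∑ u, ∑ v, if G.Adj u v then φ u v else 0 := by
  have hinj : Function.Injective
      (Sum.elim (fun e => (s e, t e)) (fun e => (t e, s e)) : E ⊕ E → V × V) := by
    rintro (e | e) (e' | e') he <;> simp only [Sum.elim_inl, Sum.elim_inr, Prod.mk.injEq] at he
    · rw [h.injective _ _ he.1 he.2]
    · exact (h.oriented _ _ he.1 he.2).elim
    · exact (h.oriented _ _ he.2 he.1).elim
    · rw [h.injective _ _ he.2 he.1]
  have himg : Finset.univ.image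
      (Sum.elim (fun e => (s e, t e)) (fun e => (t e, s e)) : E ⊕ E → V × V) =
      Finset.univ.filter fun d => G.Adj d.1 d.2 := by
    ext ⟨u, v⟩
    simp only [Finset.mem_image, Finset.mem_univ, true_and, Sum.exists, Sum.elim_inl,
      Sum.elim_inr, Prod.mk.injEq, Finset.mem_filter]
    constructor
    · rintro (⟨e, rfl, rfl⟩ | ⟨e, rfl, rfl⟩)
      · exact h.adj_source_target e
      · exact (h.adj_source_target e).symm
    · intro huv
      obtain ⟨e, ⟨h1, h2⟩ | ⟨h1, h2⟩⟩ := h.exists_of_adj u v huv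
      · exact Or.inl ⟨e, h1, h2⟩
      · exact Or.inr ⟨e, h2, h1⟩
  rw [← Fintype.sum_prod_type', ← Finset.sum_filter, ← himg, Finset.sum_image hinj.injOn,
    Fintype.sum_sum_type, Finset.sum_add_distrib]
  rfl

/-- The signed incidence matrix of an enumeration of oriented edges, without the row of `r`. -/
def reducedIncidence {V E : Type*} [DecidableEq V] (r : V) (s t : E → V) :
    Matrix {v // v ≠ r} E ℝ :=
  Matrix.of fun v e => (if t e = v then 1 else 0) - (if s e = v then 1 else 0)

theorem IsEdgeEnumeration.reducedLaplacian_eq {V E : Type*} [Fintype V] [DecidableEq V]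
    [Fintype E] {G : SimpleGraph V} {s t : E → V} (h : IsEdgeEnumeration G s t) (r : V) :
    reducedLaplacian G r = reducedIncidence r s t * (reducedIncidence r s t)ᵀ := by
  classical
  ext v w
  have h1 := h.sum_darts fun a b => if a = v then
    (if (a : V) = w then (1 : ℝ) else 0) - (if b = w then 1 else 0) else 0
  have h2 : reducedLaplacian G r v w = ∑ a, ∑ b, if G.Adj a b then (if a = v then
      (if (a : V) = w then (1 : ℝ) else 0) - (if b = w then 1 else 0) else 0) else 0 := by
    rw [Finset.sum_eq_single (v : V)]
    · simp [reducedLaplacian, Subtype.ext_iff]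
    · intro a _ ha
      simp [ha]
    · simp
  rw [h2, ← h1, mul_apply]
  refine Finset.sum_congr rfl fun e _ => ?_
  simp only [reducedIncidence, transpose_apply, of_apply]
  split_ifs <;> simp

/-- If the rows of `(B₁ B₂)` are orthogonal to those of `(C₁ C₂)`, and `B₁` and `C₂` are
unimodular, then the Gram matrices of the two sets of rows have the same determinant: they are
conjugate to `1 + N Nᵀ` and `1 + Nᵀ N`, where `N = B₁⁻¹ B₂`. -/
theorem det_gram_eq_det_gram_of_orthogonal {V F : Type*} [Fintype V] [DecidableEq V] [Fintype F]
    [DecidableEq F] (B₁ : Matrix V V ℝ) (B₂ : Matrix V F ℝ) (C₁ : Matrix F V ℝ)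
    (C₂ : Matrix F F ℝ) (h : B₁ * C₁ᵀ + B₂ * C₂ᵀ = 0) (hB : B₁.det ^ 2 = 1)
    (hC : C₂.det ^ 2 = 1) :
    (B₁ * B₁ᵀ + B₂ * B₂ᵀ).det = (C₁ * C₁ᵀ + C₂ * C₂ᵀ).det := by
  have hu : IsUnit B₁.det := isUnit_iff_ne_zero.mpr fun h0 => by simp [h0] at hB
  set N := B₁⁻¹ * B₂ with hN
  have hB₂ : B₂ = B₁ * N := by rw [hN, Matrix.mul_nonsing_inv_cancel_left _ _ hu]
  have hC₁' : C₁ᵀ = -(N * C₂ᵀ) := by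
    have h1 : B₁ * (C₁ᵀ + N * C₂ᵀ) = 0 := by
      rw [Matrix.mul_add, ← Matrix.mul_assoc, ← hB₂, h]
    have h2 := congrArg (B₁⁻¹ * ·) h1
    simp only [Matrix.nonsing_inv_mul_cancel_left _ _ hu, Matrix.mul_zero] at h2
    exact eq_neg_of_add_eq_zero_left h2
  have hC₁ : C₁ = -(C₂ * Nᵀ) := by
    rw [← transpose_transpose C₁, hC₁']
    simp
  have e1 : B₁ * B₁ᵀ + B₂ * B₂ᵀ = B₁ * (1 + N * Nᵀ) * B₁ᵀ := by
    rw [hB₂, transpose_mul]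
    simp only [Matrix.mul_add, Matrix.add_mul, Matrix.mul_one, Matrix.mul_assoc]
  have e2 : C₁ * C₁ᵀ + C₂ * C₂ᵀ = C₂ * (1 + Nᵀ * N) * C₂ᵀ := by
    rw [hC₁', hC₁]
    simp only [Matrix.mul_add, Matrix.add_mul, Matrix.neg_mul, Matrix.mul_neg, neg_neg,
      Matrix.mul_one, Matrix.mul_assoc]
    rw [add_comm]
  rw [e1, e2, det_mul, det_mul, det_mul, det_mul, det_transpose, det_transpose,
    det_one_add_mul_comm N]
  linear_combination (1 + Nᵀ * N).det * (hB - hC)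

/-! ### Staircase-shaped pieces of the square lattice -/

/-- The subgraph of the square lattice induced by a finite set `S` of lattice points. -/
def latticeGraph (S : Finset (ℕ × ℕ)) : SimpleGraph S where
  Adj u v := (u.1.1 = v.1.1 ∧ (u.1.2 + 1 = v.1.2 ∨ v.1.2 + 1 = u.1.2)) ∨
    (u.1.2 = v.1.2 ∧ (u.1.1 + 1 = v.1.1 ∨ v.1.1 + 1 = u.1.1))
  symm := ⟨fun u v h => by grind⟩
  loopless := ⟨fun u h => by omega⟩

/-- The unit squares with all corners in the lower set `S`, named by their lower left corners. -/
def faces (S : Finset (ℕ × ℕ)) : Finset (ℕ × ℕ) := S.filter fun f => (f.1 + 1, f.2 + 1) ∈ S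

/-- The Laplacian of the inner dual graph with Dirichlet boundary conditions. -/
def faceMatrix (S : Finset (ℕ × ℕ)) : Matrix (faces S) (faces S) ℝ :=
  Matrix.of fun f g =>
    if f = g then 4 else
    if (f.1.1 = g.1.1 ∧ (f.1.2 + 1 = g.1.2 ∨ g.1.2 + 1 = f.1.2)) ∨
      (f.1.2 = g.1.2 ∧ (f.1.1 + 1 = g.1.1 ∨ g.1.1 + 1 = f.1.1)) then -1 else 0

section Staircase

variable {S : Finset (ℕ × ℕ)}

theorem mem_of_le_of_isLowerSet (hS : IsLowerSet (S : Set (ℕ × ℕ))) {v : ℕ × ℕ} (hv : v ∈ S)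
    {a b : ℕ} (ha : a ≤ v.1) (hb : b ≤ v.2) : (a, b) ∈ S :=
  hS (show (a, b) ≤ v from ⟨ha, hb⟩) hv

theorem corner_mem_of_mem_faces (hS : IsLowerSet (S : Set (ℕ × ℕ))) (f : faces S) {a b : ℕ}
    (ha : a ≤ f.1.1 + 1) (hb : b ≤ f.1.2 + 1) : (a, b) ∈ S :=
  mem_of_le_of_isLowerSet hS (Finset.mem_filter.mp f.2).2 ha hb

/-- The corner of the lattice graph, the root of the comb tree. -/
def cornerVertex (hS : IsLowerSet (S : Set (ℕ × ℕ))) (h : S.Nonempty) : S :=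
  ⟨(0, 0), h.elim fun _ hv => mem_of_le_of_isLowerSet hS hv (Nat.zero_le _) (Nat.zero_le _)⟩

/-- The parent of a lattice point in the comb, the spanning tree that consists of all vertical
edges and of the bottom row. -/
def combParent (v : ℕ × ℕ) : ℕ × ℕ := if v.2 = 0 then (v.1 - 1, 0) else (v.1, v.2 - 1)

theorem combParent_mem (hS : IsLowerSet (S : Set (ℕ × ℕ))) {v : ℕ × ℕ} (hv : v ∈ S) :
    combParent v ∈ S := by
  unfold combParent
  split_ifs
  · exact mem_of_le_of_isLowerSet hS hv (Nat.sub_le _ _) (Nat.zero_le _)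
  · exact mem_of_le_of_isLowerSet hS hv le_rfl (Nat.sub_le _ _)

variable (hS : IsLowerSet (S : Set (ℕ × ℕ))) (hne : S.Nonempty)

/-- Sources of the edges of the lattice graph. An edge of the comb is named by its upper or right
end, the other edges, which are horizontal, by the face below them. -/
def edgeSource : {v // v ≠ cornerVertex hS hne} ⊕ faces S → S :=
  Sum.elim (fun v => ⟨combParent v.1.1, combParent_mem hS v.1.2⟩)
    (fun f => ⟨(f.1.1, f.1.2 + 1), corner_mem_of_mem_faces hS f (Nat.le_succ _) le_rfl⟩)

/-- Targets of the edges of the lattice graph. -/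
def edgeTarget : {v // v ≠ cornerVertex hS hne} ⊕ faces S → S :=
  Sum.elim (fun v => v.1)
    (fun f => ⟨(f.1.1 + 1, f.1.2 + 1), corner_mem_of_mem_faces hS f le_rfl le_rfl⟩)

theorem ne_cornerVertex_iff (v : S) :
    v ≠ cornerVertex hS hne ↔ 0 < v.1.1 ∨ 0 < v.1.2 := by
  obtain ⟨⟨x, y⟩, hv⟩ := v
  simp only [cornerVertex, ne_eq, Subtype.mk.injEq, Prod.mk.injEq]
  omega

theorem isEdgeEnumeration_latticeGraph :
    IsEdgeEnumeration (latticeGraph S) (edgeSource hS hne) (edgeTarget hS hne) where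
  adj_source_target := by
    rintro (⟨⟨⟨x, y⟩, hv⟩, hr⟩ | ⟨⟨x, y⟩, hf⟩)
    · rw [ne_cornerVertex_iff] at hr
      simp only [edgeSource, edgeTarget, Sum.elim_inl, latticeGraph, combParent]
      split_ifs <;> grind
    · simp [edgeSource, edgeTarget, latticeGraph]
  exists_of_adj := by
    have key : ∀ u v : S, (u.1.1 = v.1.1 ∧ u.1.2 + 1 = v.1.2) ∨
        (u.1.2 = v.1.2 ∧ u.1.1 + 1 = v.1.1) →
        ∃ e, edgeSource hS hne e = u ∧ edgeTarget hS hne e = v := by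
      rintro ⟨⟨x, y⟩, hu⟩ ⟨⟨x', y'⟩, hv⟩ h
      simp only at h
      by_cases hc : x = x' ∨ y' = 0
      · refine ⟨Sum.inl ⟨⟨(x', y'), hv⟩, ?_⟩, ?_⟩
        · rw [ne_cornerVertex_iff]
          grind
        · simp only [edgeSource, edgeTarget, Sum.elim_inl, combParent, Subtype.mk.injEq]
          split_ifs <;> grind
      · refine ⟨Sum.inr ⟨(x, y - 1), ?_⟩, ?_⟩
        · have h1 : (x + 1, y - 1 + 1) = (x', y') := by grind
          refine Finset.mem_filter.mpr ⟨?_, h1 ▸ hv⟩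
          exact mem_of_le_of_isLowerSet hS hu le_rfl (Nat.sub_le _ _)
        · simp only [edgeSource, edgeTarget, Sum.elim_inr, Subtype.mk.injEq]
          grind
    intro u v h
    rcases h with ⟨h1, h2 | h2⟩ | ⟨h1, h2 | h2⟩
    · exact (key u v (Or.inl ⟨h1, h2⟩)).imp fun e => Or.inl
    · exact (key v u (Or.inl ⟨h1.symm, h2⟩)).imp fun e => Or.inr
    · exact (key u v (Or.inr ⟨h1, h2⟩)).imp fun e => Or.inl
    · exact (key v u (Or.inr ⟨h1.symm, h2⟩)).imp fun e => Or.inr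
  injective := by
    rintro (⟨⟨⟨x, y⟩, hv⟩, hr⟩ | ⟨⟨x, y⟩, hf⟩) (⟨⟨⟨x', y'⟩, hv'⟩, hr'⟩ | ⟨⟨x', y'⟩, hf'⟩) <;>
      simp only [edgeSource, edgeTarget, Sum.elim_inl, Sum.elim_inr, combParent,
        Subtype.mk.injEq, Prod.mk.injEq, Sum.inl.injEq, Sum.inr.injEq] <;>
      (try split_ifs) <;> grind
  oriented := by
    rintro (⟨⟨⟨x, y⟩, hv⟩, hr⟩ | ⟨⟨x, y⟩, hf⟩) (⟨⟨⟨x', y'⟩, hv'⟩, hr'⟩ | ⟨⟨x', y'⟩, hf'⟩) <;>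
      (try have hv₀ := (ne_cornerVertex_iff hS hne _).mp hr) <;>
      (try have hv₁ := (ne_cornerVertex_iff hS hne _).mp hr') <;>
      simp only [edgeSource, edgeTarget, Sum.elim_inl, Sum.elim_inr, combParent,
        Subtype.mk.injEq, Prod.mk.injEq] <;>
      (try split_ifs) <;> grind

end Staircase

/-! ### Face boundaries and the spanning trees of a staircase -/

section FaceBoundary

/-- The coefficient of the comb edge with upper or right end `v` in the boundary of the face `f`:
the right side, the left side, and the bottom side if it lies on the bottom row. -/
def combCoeff (f v : ℕ × ℕ) : ℝ :=
  (if v = (f.1 + 1, f.2 + 1) then 1 else 0) - (if v = (f.1, f.2 + 1) then 1 else 0) +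
    (if f.2 = 0 ∧ v = (f.1 + 1, 0) then 1 else 0)

/-- The coefficient of the horizontal edge above the face `g` in the boundary of the face `f`:
the top side, and the bottom side if it does not lie on the bottom row. -/
def cotreeCoeff (f g : ℕ × ℕ) : ℝ :=
  (if f.2 ≠ 0 ∧ g = (f.1, f.2 - 1) then 1 else 0) - (if g = f then 1 else 0)

variable {S : Finset (ℕ × ℕ)} (hS : IsLowerSet (S : Set (ℕ × ℕ))) (hne : S.Nonempty)

theorem sum_combCoeff_mul (f : faces S) (φ : ℕ × ℕ → ℝ) :
    ∑ v : {v // v ≠ cornerVertex hS hne}, combCoeff f.1 v.1.1 * φ v.1.1 =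
      φ (f.1.1 + 1, f.1.2 + 1) - φ (f.1.1, f.1.2 + 1) +
        if f.1.2 = 0 then φ (f.1.1 + 1, 0) else 0 := by
  have single : ∀ c : ℕ × ℕ, c ∈ S → (0 < c.1 ∨ 0 < c.2) →
      ∑ v : {v // v ≠ cornerVertex hS hne}, (if v.1.1 = c then (1 : ℝ) else 0) * φ v.1.1 = φ c := by
    intro c hc hpos
    rw [Finset.sum_eq_single ⟨⟨c, hc⟩, (ne_cornerVertex_iff hS hne _).mpr hpos⟩]
    · simp
    · intro v _ hv
      have : v.1.1 ≠ c := fun h => hv (by ext1; ext1; exact h)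
      simp [this]
    · simp
  simp only [combCoeff, add_mul, sub_mul, Finset.sum_add_distrib, Finset.sum_sub_distrib]
  rw [single _ (corner_mem_of_mem_faces hS f le_rfl le_rfl) (Or.inl (Nat.succ_pos _)),
    single _ (corner_mem_of_mem_faces hS f (Nat.le_succ _) le_rfl) (Or.inr (Nat.succ_pos _))]
  congr 1
  by_cases hy : f.1.2 = 0
  · simp only [hy, true_and, if_true]
    exact single _ (corner_mem_of_mem_faces hS f le_rfl (Nat.zero_le _)) (Or.inl (Nat.succ_pos _))
  · simp [hy]

theorem sum_cotreeCoeff_mul {S : Finset (ℕ × ℕ)} (hS : IsLowerSet (S : Set (ℕ × ℕ))) (f : faces S) (φ : ℕ × ℕ → ℝ) :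
    ∑ g : faces S, cotreeCoeff f.1 g.1 * φ g.1 =
      (if f.1.2 ≠ 0 then φ (f.1.1, f.1.2 - 1) else 0) - φ f.1 := by
  have hmem : f.1.2 ≠ 0 → (f.1.1, f.1.2 - 1) ∈ faces S := fun hy => Finset.mem_filter.mpr
    ⟨corner_mem_of_mem_faces hS f (Nat.le_succ _) (by omega),
      corner_mem_of_mem_faces hS f le_rfl (by omega)⟩
  rw [Finset.sum_coe_sort (faces S) fun g => cotreeCoeff f.1 g * φ g]
  simp only [cotreeCoeff, sub_mul, Finset.sum_sub_distrib]
  by_cases hy : f.1.2 = 0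
  · simp [hy]
  · simp [hy, hmem hy]

/-- The value at the point `w` of the signed incidence vector of the comb edge with upper or right
end `v`. -/
def combIncidence (w v : ℕ × ℕ) : ℝ :=
  (if v = w then 1 else 0) - (if combParent v = w then 1 else 0)

/-- The value at the point `w` of the signed incidence vector of the horizontal edge above the
face `g`. -/
def cotreeIncidence (w g : ℕ × ℕ) : ℝ :=
  (if (g.1 + 1, g.2 + 1) = w then 1 else 0) - (if (g.1, g.2 + 1) = w then 1 else 0)

/-- The boundary of a face is a cycle. -/
theorem incidence_face_boundary (x y : ℕ) (w : ℕ × ℕ) :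
    combIncidence w (x + 1, y + 1) - combIncidence w (x, y + 1) +
        (if y = 0 then combIncidence w (x + 1, 0) else 0) +
      ((if y ≠ 0 then cotreeIncidence w (x, y - 1) else 0) - cotreeIncidence w (x, y)) = 0 := by
  cases y <;> simp [combIncidence, cotreeIncidence, combParent] <;> ring

/-- The intersection numbers of the boundaries of two faces. -/
theorem face_boundary_inner (f g : ℕ × ℕ) :
    combCoeff g (f.1 + 1, f.2 + 1) - combCoeff g (f.1, f.2 + 1) +
        (if f.2 = 0 then combCoeff g (f.1 + 1, 0) else 0) +
      ((if f.2 ≠ 0 then cotreeCoeff g (f.1, f.2 - 1) else 0) - cotreeCoeff g f) =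
    if f = g then 4 else
    if (f.1 = g.1 ∧ (f.2 + 1 = g.2 ∨ g.2 + 1 = f.2)) ∨
      (f.2 = g.2 ∧ (f.1 + 1 = g.1 ∨ g.1 + 1 = f.1)) then -1 else 0 := by
  obtain ⟨x, y⟩ := f
  obtain ⟨a, b⟩ := g
  rcases y with _ | y <;> rcases b with _ | b <;>
    rcases lt_trichotomy x a with h | rfl | h <;>
    simp only [combCoeff, cotreeCoeff, Prod.mk.injEq] <;> grind

end FaceBoundary

section Determinants

variable {S : Finset (ℕ × ℕ)} (hS : IsLowerSet (S : Set (ℕ × ℕ))) (hne : S.Nonempty)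

theorem isParentFun_combParent :
    IsParentFun fun v : {v // v ≠ cornerVertex hS hne} =>
      (⟨combParent v.1.1, combParent_mem hS v.1.2⟩ : S) := by
  refine Subrelation.wf ?_
    (InvImage.wf (fun v : {v // v ≠ cornerVertex hS hne} => v.1.1.1 + v.1.1.2) wellFounded_lt)
  rintro ⟨⟨⟨x, y⟩, hv⟩, hr⟩ ⟨⟨⟨x', y'⟩, hv'⟩, hr'⟩ h
  have hpos := (ne_cornerVertex_iff hS hne _).mp hr'
  simp only [combParent, Subtype.mk.injEq] at h
  simp only [InvImage]
  split_ifs at h <;> grind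

/-- The face below a face, if there is one. -/
def faceBelow (f : faces S) : Option (faces S) :=
  if h : f.1.2 ≠ 0 ∧ (f.1.1, f.1.2 - 1) ∈ faces S then some ⟨_, h.2⟩ else none

theorem wellFounded_faceBelow :
    WellFounded fun g f : faces S => faceBelow f = some g := by
  refine Subrelation.wf ?_ (InvImage.wf (fun f : faces S => f.1.2) wellFounded_lt)
  rintro ⟨⟨x, y⟩, hf⟩ ⟨⟨x', y'⟩, hf'⟩ h
  simp only [InvImage]
  unfold faceBelow at h
  split_ifs at h
  grind

/-- For a staircase-shaped piece of the square lattice, the number of spanning trees is the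
determinant of the Dirichlet Laplacian on its faces. -/
theorem numSpanningTrees_latticeGraph (hS : IsLowerSet (S : Set (ℕ × ℕ))) (hne : S.Nonempty) :
    (numSpanningTrees (latticeGraph S) : ℝ) = (faceMatrix S).det := by
  set r := cornerVertex hS hne
  let B₁ : Matrix {v // v ≠ r} {v // v ≠ r} ℝ := of fun w v => combIncidence w.1.1 v.1.1
  let B₂ : Matrix {v // v ≠ r} (faces S) ℝ := of fun w g => cotreeIncidence w.1.1 g.1
  let C₁ : Matrix (faces S) {v // v ≠ r} ℝ := of fun f v => combCoeff f.1 v.1.1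
  let C₂ : Matrix (faces S) (faces S) ℝ := of fun f g => cotreeCoeff f.1 g.1
  have hL : reducedLaplacian (latticeGraph S) r = B₁ * B₁ᵀ + B₂ * B₂ᵀ := by
    rw [(isEdgeEnumeration_latticeGraph hS hne).reducedLaplacian_eq r]
    ext v w
    simp only [mul_apply, Matrix.add_apply, Fintype.sum_sum_type, transpose_apply]
    congr 1
    · refine Finset.sum_congr rfl fun e _ => ?_
      simp only [B₁, combIncidence, reducedIncidence, edgeSource, edgeTarget, Sum.elim_inl,
        of_apply, Subtype.ext_iff]
      congr!
    · refine Finset.sum_congr rfl fun e _ => ?_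
      simp only [B₂, cotreeIncidence, reducedIncidence, edgeSource, edgeTarget, Sum.elim_inr,
        of_apply, Subtype.ext_iff]
      congr!
  have hM : faceMatrix S = C₁ * C₁ᵀ + C₂ * C₂ᵀ := by
    ext f g
    simp only [mul_apply, Matrix.add_apply, transpose_apply, C₁, C₂, of_apply]
    rw [sum_combCoeff_mul hS hne f (combCoeff g.1), sum_cotreeCoeff_mul hS f (cotreeCoeff g.1),
      face_boundary_inner]
    simp only [faceMatrix, of_apply, Subtype.ext_iff]
  have horth : B₁ * C₁ᵀ + B₂ * C₂ᵀ = 0 := by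
    ext w f
    simp only [mul_apply, Matrix.add_apply, transpose_apply, B₁, B₂, C₁, C₂, of_apply,
      mul_comm _ (combCoeff _ _), mul_comm _ (cotreeCoeff _ _)]
    rw [sum_combCoeff_mul hS hne f (combIncidence w.1.1),
      sum_cotreeCoeff_mul hS f (cotreeIncidence w.1.1), incidence_face_boundary]
    rfl
  have hdetB : B₁.det = 1 := by
    rw [← det_transpose]
    have := det_one_sub_partialFunMatrix
      (restrictParent fun v : {v // v ≠ r} => (⟨combParent v.1.1, combParent_mem hS v.1.2⟩ : S))
      (by simp only [restrictParent_eq_some]; exact isParentFun_combParent hS hne)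
    rw [← this]
    congr 1
    ext v w
    simp only [B₁, combIncidence, partialFunMatrix, restrictParent_eq_some, Matrix.one_apply,
      transpose_apply, of_apply, Matrix.sub_apply, Subtype.ext_iff]
  have hdetC : C₂.det ^ 2 = 1 := by
    have h1 : C₂ = -(1 - partialFunMatrix faceBelow) := by
      ext f g
      have h2 : faceBelow f = some g ↔ f.1.2 ≠ 0 ∧ g.1 = (f.1.1, f.1.2 - 1) := by
        unfold faceBelow
        split_ifs with h
        · simp [Subtype.ext_iff, h.1, eq_comm (b := g.1)]
        · simp only [false_iff]
          rintro ⟨h3, h4⟩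
          exact h ⟨h3, h4 ▸ g.2⟩
      have h3 : f = g ↔ g.1 = f.1 := by rw [eq_comm, Subtype.ext_iff]
      simp only [C₂, cotreeCoeff, partialFunMatrix, Matrix.one_apply, h2, h3, of_apply,
        Matrix.neg_apply, Matrix.sub_apply, neg_sub]
    rw [h1, det_neg, det_one_sub_partialFunMatrix _ wellFounded_faceBelow, mul_one, ← pow_mul,
      mul_comm, pow_mul]
    simp
  rw [numSpanningTrees_eq_det _ r, hL, hM]
  exact det_gram_eq_det_gram_of_orthogonal _ _ _ _ horth (by rw [hdetB, one_pow]) hdetC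

end Determinants

/-! ### Kronecker sums and their antisymmetric parts -/

section Antisymmetric

variable {ι : Type*} [LinearOrder ι]

@[to_additive]
theorem prod_prod_eq_prod_lt_mul_prod_diag [Fintype ι] {M : Type*} [CommMonoid M] (f : ι × ι → M) :
    ∏ c, f c = (∏ c : {c : ι × ι // c.1 < c.2}, f c.1 * f c.1.swap) * ∏ i, f (i, i) := by
  rw [← Finset.prod_filter_mul_prod_filter_not _ (fun c : ι × ι => c.1 < c.2),
    ← Finset.prod_filter_mul_prod_filter_not (Finset.univ.filter fun c : ι × ι => ¬ c.1 < c.2)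
      (fun c => c.2 < c.1), Finset.prod_mul_distrib, ← mul_assoc]
  congr 1
  · congr 1
    · exact Finset.prod_subtype _ (by simp) f
    · rw [← Finset.prod_subtype (Finset.univ.filter fun c : ι × ι => c.1 < c.2) (by simp)
        fun c => f c.swap]
      refine Finset.prod_nbij' Prod.swap Prod.swap ?_ ?_ ?_ ?_ ?_ <;>
        simp +contextual [le_of_lt]
  · refine Finset.prod_nbij' Prod.fst (fun i => (i, i)) ?_ ?_ ?_ ?_ ?_ <;>
      simp only [Finset.mem_filter, Finset.mem_univ, true_and, not_lt, and_imp, Prod.forall,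
        Prod.mk.injEq, le_refl, and_self, implies_true]
    · exact fun a b h1 h2 => le_antisymm h2 h1
    · exact fun a b h1 h2 => by rw [le_antisymm h1 h2]

/-- The action of a matrix on `V ⊗ V` that commutes with the swap of the two factors on the
antisymmetric tensors, in the basis of the `e_a ⊗ e_b - e_b ⊗ e_a` with `a < b`. -/
def antisymmetricPart (M : Matrix (ι × ι) (ι × ι) ℝ) :
    Matrix {c : ι × ι // c.1 < c.2} {c : ι × ι // c.1 < c.2} ℝ :=
  of fun p q => M p.1 q.1 - M p.1 q.1.swap

theorem antisymmetricPart_mul [Fintype ι] (M N : Matrix (ι × ι) (ι × ι) ℝ)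
    (hN : ∀ p q, N p.swap q.swap = N p q) :
    antisymmetricPart (M * N) = antisymmetricPart M * antisymmetricPart N := by
  ext p q
  simp only [antisymmetricPart, of_apply, mul_apply, ← Finset.sum_sub_distrib]
  rw [sum_sum_eq_sum_lt_add_sum_diag]
  have hN' : ∀ p q, N p.swap q = N p q.swap := fun p q => by
    rw [← hN p q.swap, Prod.swap_swap]
  have hdiag : ∀ i q, N (i, i) q.swap = N (i, i) q := fun i q => hN (i, i) q
  simp only [hdiag, sub_self, Finset.sum_const_zero, add_zero]
  refine Finset.sum_congr rfl fun c _ => ?_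
  rw [hN', hN', Prod.swap_swap]
  ring

theorem antisymmetricPart_diagonal (d : ι × ι → ℝ) :
    antisymmetricPart (diagonal d) = diagonal fun c => d c.1 := by
  ext p q
  have h : p.1 ≠ q.1.swap := fun h => by
    have h1 := p.2
    rw [h] at h1
    exact lt_asymm h1 q.2
  simp [antisymmetricPart, diagonal_apply, h, Subtype.ext_iff]

/-- The Kronecker sum `P ⊗ 1 + 1 ⊗ P`. -/
def kroneckerSum (P : Matrix ι ι ℝ) : Matrix (ι × ι) (ι × ι) ℝ := P ⊗ₖ 1 + 1 ⊗ₖ P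

/-- In an eigenbasis of `P` with eigenvalues `μ`, the Kronecker sum has the eigenvalues
`μ j + μ k` for all `j` and `k`, and its antisymmetric part those with `j < k`. The remaining
factors `2 * μ j` multiply to `2 ^ card ι * det P`. -/
theorem det_kroneckerSum [Fintype ι] (P : Matrix ι ι ℝ) (hP : P.IsHermitian) :
    (kroneckerSum P).det =
      2 ^ Fintype.card ι * P.det * (antisymmetricPart (kroneckerSum P)).det ^ 2 := by
  set U := (hP.eigenvectorUnitary : Matrix ι ι ℝ)
  set μ := hP.eigenvalues
  have hUU : U * star U = 1 := Unitary.coe_mul_star_self _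
  have hspec : P = U * diagonal μ * star U := by
    have := hP.spectral_theorem
    rw [Unitary.conjStarAlgAut_apply] at this
    exact this
  have hT : (U ⊗ₖ U) * (star U ⊗ₖ star U) = 1 := by
    rw [← mul_kronecker_mul, hUU, one_kronecker_one]
  let d : ι × ι → ℝ := fun c => μ c.1 + μ c.2
  have hdiag : diagonal d = diagonal μ ⊗ₖ 1 + 1 ⊗ₖ diagonal μ := by
    ext ⟨a, b⟩ ⟨a', b'⟩
    by_cases h1 : a = a' <;> by_cases h2 : b = b' <;>
      simp [d, kroneckerMap_apply, h1, h2]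
  have hK : kroneckerSum P = (U ⊗ₖ U) * (diagonal d * (star U ⊗ₖ star U)) := by
    rw [hdiag, Matrix.add_mul, Matrix.mul_add, ← mul_kronecker_mul, ← mul_kronecker_mul,
      ← mul_kronecker_mul, ← mul_kronecker_mul, Matrix.one_mul, hUU, ← Matrix.mul_assoc,
      ← hspec]
    rfl
  have hconj : ∀ {κ : Type _} [Fintype κ] [DecidableEq κ] (A D B : Matrix κ κ ℝ), A * B = 1 →
      (A * (D * B)).det = D.det := by
    intro κ _ _ A D B h
    have := congrArg det h
    rw [det_mul, det_one] at this
    rw [det_mul, det_mul]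
    linear_combination D.det * this
  have hdetK : (kroneckerSum P).det = ∏ c, d c := by
    rw [hK, hconj _ _ _ hT, det_diagonal]
  have hdetA : (antisymmetricPart (kroneckerSum P)).det =
      ∏ c : {c : ι × ι // c.1 < c.2}, d c.1 := by
    have hswap : ∀ p q, (star U ⊗ₖ star U) (Prod.swap p) (Prod.swap q) =
        (star U ⊗ₖ star U) p q := fun p q => by simp [kroneckerMap_apply, mul_comm]
    have hswapd : ∀ p q, diagonal d (Prod.swap p) (Prod.swap q) = diagonal d p q := fun p q => by
      simp [diagonal_apply, d, add_comm]
    have hswapm : ∀ p q, (diagonal d * (star U ⊗ₖ star U)) (Prod.swap p) (Prod.swap q) =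
        (diagonal d * (star U ⊗ₖ star U)) p q := fun p q => by
      rw [diagonal_mul, diagonal_mul, hswap]
      simp [d, add_comm]
    rw [hK, antisymmetricPart_mul _ _ hswapm, antisymmetricPart_mul _ _ hswap, hconj,
      antisymmetricPart_diagonal, det_diagonal]
    rw [← antisymmetricPart_mul _ _ hswap, hT, ← diagonal_one, antisymmetricPart_diagonal,
      diagonal_one]
  have hdetP : P.det = ∏ i, μ i := by
    rw [hP.det_eq_prod_eigenvalues]
    rfl
  rw [hdetK, hdetA, hdetP, prod_prod_eq_prod_lt_mul_prod_diag, ← Finset.prod_pow, mul_comm]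
  congr 1
  · simp only [d, ← two_mul, Finset.prod_mul_distrib, Finset.prod_const, Finset.card_univ]
  · exact Finset.prod_congr rfl fun c _ => by simp only [d, Prod.fst_swap, Prod.snd_swap]; ring

end Antisymmetric

/-! ### The Dirichlet Laplacian of a path -/

/-- The Dirichlet Laplacian of the path on `m` vertices. -/
def pathDirichlet (m : ℕ) : Matrix (Fin m) (Fin m) ℝ :=
  of fun i j => if i = j then 2 else if i.val + 1 = j.val ∨ j.val + 1 = i.val then -1 else 0

theorem pathDirichlet_isHermitian (m : ℕ) : (pathDirichlet m).IsHermitian := by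
  ext i j
  simp [pathDirichlet, eq_comm (a := j), or_comm]

/-- If `D` is the difference operator of the path, the Dirichlet Laplacian is
`D * (1 + u * uᵀ) * Dᵀ` with `u` the all-ones vector, because `D * u` is the first basis vector. -/
theorem det_pathDirichlet (m : ℕ) : (pathDirichlet m).det = m + 1 := by
  let pred : Fin m → Option (Fin m) := fun i => if h : i.val = 0 then none else
    some ⟨i.val - 1, by omega⟩
  have hwf : WellFounded fun j i => pred i = some j := by
    refine Subrelation.wf ?_ (InvImage.wf (fun i : Fin m => i.val) wellFounded_lt)
    intro j i h
    simp only [pred, InvImage] at h ⊢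
    split_ifs at h
    grind
  let D : Matrix (Fin m) (Fin m) ℝ := 1 - partialFunMatrix pred
  let u : Matrix (Fin m) Unit ℝ := replicateCol Unit 1
  have hD : D.det = 1 := det_one_sub_partialFunMatrix pred hwf
  have hentry : ∀ i j, D i j = (if j = i then 1 else 0) - (if j.val + 1 = i.val then 1 else 0) := by
    intro i j
    have : pred i = some j ↔ j.val + 1 = i.val := by
      simp only [pred]
      split_ifs <;> grind
    simp [D, partialFunMatrix, Matrix.one_apply, this, eq_comm (a := i)]
  have hsum : ∀ (φ : ℕ → ℝ) (i : Fin m), ∑ k, D i k * φ k =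
      φ i - if i.val = 0 then 0 else φ (i.val - 1) := by
    intro φ i
    have := partialFunMatrix_mulVec pred (fun k => φ k) i
    have h2 : ∑ k, D i k * φ k = (D *ᵥ fun k => φ k) i := rfl
    rw [h2, sub_mulVec, Pi.sub_apply, one_mulVec, this]
    simp only [pred]
    split_ifs <;> simp
  have hDu : D * u = of fun i _ => if i.val = 0 then (1 : ℝ) else 0 := by
    ext i k
    have := hsum (fun _ => 1) i
    simp only [mul_apply, u, replicateCol_apply, Pi.one_apply, of_apply]
    rw [this]
    split_ifs <;> simp
  have hP : pathDirichlet m = D * (1 + u * uᵀ) * Dᵀ := by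
    have h1 : D * (1 + u * uᵀ) * Dᵀ = D * Dᵀ + (D * u) * (D * u)ᵀ := by
      rw [transpose_mul]
      simp only [Matrix.mul_add, Matrix.add_mul, Matrix.mul_one, Matrix.mul_assoc]
    rw [h1, hDu]
    ext i j
    have h2 := hsum (fun k => (if k = j.val then 1 else 0) - (if k + 1 = j.val then 1 else 0)) i
    have h3 : (D * Dᵀ) i j = ∑ k, D i k *
        ((if k.val = j.val then 1 else 0) - (if k.val + 1 = j.val then 1 else 0)) := by
      simp only [mul_apply, transpose_apply, hentry j, Fin.ext_iff]
    rw [Matrix.add_apply, h3, h2]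
    simp only [pathDirichlet, of_apply, mul_apply, transpose_apply, Finset.univ_unique,
      Finset.sum_const, Finset.card_singleton, one_smul, Fin.ext_iff]
    grind
  rw [hP, det_mul, det_mul, det_transpose, hD, det_one_add_mul_comm, det_unique]
  simp [u, mul_apply, add_comm]

/-! ### The square lattice and the quartered Aztec diamond -/

theorem numSpanningTrees_congr {V W : Type*} {G : SimpleGraph V} {H : SimpleGraph W}
    (e : G ≃g H) : numSpanningTrees G = numSpanningTrees H := by
  rw [numSpanningTrees, numSpanningTrees]
  refine Set.ncard_congr (fun T _ => T.map e.toEquiv.toEmbedding) ?_ ?_ ?_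
  · rintro T ⟨hT, hT'⟩
    refine ⟨?_, (SimpleGraph.Iso.map e.toEquiv T).isTree_iff.mp hT'⟩
    rintro _ _ ⟨-, a, b, h, rfl, rfl⟩
    exact e.map_rel_iff.mpr (hT h)
  · intro T T' _ _ h
    exact SimpleGraph.map_injective _ h
  · rintro T ⟨hT, hT'⟩
    refine ⟨T.comap e.toEquiv.toEmbedding, ⟨?_, ?_⟩, ?_⟩
    · intro a b h
      exact e.map_rel_iff.mp (hT h)
    · exact (SimpleGraph.Iso.comap e.toEquiv T).isTree_iff.mpr hT'
    · ext a b
      simp only [SimpleGraph.map_adj, SimpleGraph.comap_adj]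
      constructor
      · rintro ⟨u, v, h, rfl, rfl⟩
        exact h
      · intro h
        exact ⟨e.symm a, e.symm b, by simpa using h, by simp, by simp⟩

/-- The lattice points of the `n × n` square. -/
def squarePoints (n : ℕ) : Finset (ℕ × ℕ) := Finset.range n ×ˢ Finset.range n

/-- The lattice points of the triangle whose legs have `n` points. -/
def trianglePoints (n : ℕ) : Finset (ℕ × ℕ) := (squarePoints n).filter fun p => p.1 + p.2 < n

theorem mem_squarePoints {n : ℕ} {p : ℕ × ℕ} : p ∈ squarePoints n ↔ p.1 < n ∧ p.2 < n := by
  simp [squarePoints]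

theorem mem_trianglePoints {n : ℕ} {p : ℕ × ℕ} : p ∈ trianglePoints n ↔ p.1 + p.2 < n := by
  simp only [trianglePoints, Finset.mem_filter, mem_squarePoints]
  omega

theorem isLowerSet_squarePoints (n : ℕ) : IsLowerSet (squarePoints n : Set (ℕ × ℕ)) := by
  intro p q hqp hp
  rw [Finset.mem_coe, mem_squarePoints] at *
  exact ⟨hqp.1.trans_lt hp.1, hqp.2.trans_lt hp.2⟩

theorem isLowerSet_trianglePoints (n : ℕ) : IsLowerSet (trianglePoints n : Set (ℕ × ℕ)) := by
  intro p q hqp hp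
  rw [Finset.mem_coe, mem_trianglePoints] at *
  exact (add_le_add hqp.1 hqp.2).trans_lt hp

/-- The square lattice as a lattice graph on natural points. -/
def rectLatticeIso (n : ℕ) : rectLattice n n ≃g latticeGraph (squarePoints n) where
  toFun p := ⟨(p.1, p.2), mem_squarePoints.mpr ⟨p.1.2, p.2.2⟩⟩
  invFun p := (⟨p.1.1, (mem_squarePoints.mp p.2).1⟩, ⟨p.1.2, (mem_squarePoints.mp p.2).2⟩)
  left_inv _ := rfl
  right_inv _ := rfl
  map_rel_iff' := by
    rintro ⟨a, b⟩ ⟨c, d⟩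
    simp only [latticeGraph, rectLattice, SimpleGraph.boxProd_adj, SimpleGraph.pathGraph_adj,
      Equiv.coe_fn_mk, Fin.ext_iff]
    tauto

/-- The quartered Aztec diamond as a lattice graph on natural points. -/
def quarteredAztecDiamondIso (n : ℕ) :
    quarteredAztecDiamond n ≃g latticeGraph (trianglePoints n) where
  toFun p := ⟨(p.1.1.toNat, p.1.2.toNat), mem_trianglePoints.mpr (by
    obtain ⟨p, h1, h2, h3⟩ := p
    simp only
    omega)⟩
  invFun p := ⟨(p.1.1, p.1.2), by
    have := mem_trianglePoints.mp p.2
    exact ⟨by simp, by simp, by simp only; omega⟩⟩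
  left_inv := by
    rintro ⟨⟨x, y⟩, h1, h2, h3⟩
    simp only at h1 h2
    ext <;> simp [h1, h2]
  right_inv _ := by ext <;> simp
  map_rel_iff' := by
    rintro ⟨⟨x, y⟩, h1, h2, h3⟩ ⟨⟨x', y'⟩, h1', h2', h3'⟩
    simp only at h1 h2 h3 h1' h2' h3'
    lift x to ℕ using h1
    lift y to ℕ using h2
    lift x' to ℕ using h1'
    lift y' to ℕ using h2'
    simp only [latticeGraph, quarteredAztecDiamond, squareGrid, SimpleGraph.comap_adj,
      Equiv.coe_fn_mk, Int.toNat_natCast, Function.Embedding.subtype_apply, abs_eq_max_neg]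
    omega

/-- The faces of the square of side `m + 1`. -/
def facesSquareEquiv (m : ℕ) : Fin m × Fin m ≃ faces (squarePoints (m + 1)) where
  toFun p := ⟨(p.1, p.2), by
    simp only [faces, Finset.mem_filter, mem_squarePoints]
    omega⟩
  invFun f := (⟨f.1.1, by
    have := f.2
    simp only [faces, Finset.mem_filter, mem_squarePoints] at this
    omega⟩, ⟨f.1.2, by
    have := f.2
    simp only [faces, Finset.mem_filter, mem_squarePoints] at this
    omega⟩)
  left_inv _ := rfl
  right_inv _ := rfl

/-- The faces of the triangle, reflected so that the hypotenuse runs along the diagonal. -/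
def facesTriangleEquiv (m : ℕ) :
    {c : Fin m × Fin m // c.1 < c.2} ≃ faces (trianglePoints (m + 1)) where
  toFun p := ⟨(p.1.1, m - 1 - p.1.2), by
    have := p.2
    simp only [faces, Finset.mem_filter, mem_trianglePoints]
    omega⟩
  invFun f := ⟨(⟨f.1.1, by
    have := f.2
    simp only [faces, Finset.mem_filter, mem_trianglePoints] at this
    omega⟩, ⟨m - 1 - f.1.2, by
    have := f.2
    simp only [faces, Finset.mem_filter, mem_trianglePoints] at this
    omega⟩), by
    have := f.2
    simp only [faces, Finset.mem_filter, mem_trianglePoints] at this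
    simp only [Fin.mk_lt_mk]
    omega⟩
  left_inv := by
    rintro ⟨⟨a, b⟩, h⟩
    ext <;> simp only
    omega
  right_inv := by
    rintro ⟨⟨x, y⟩, h⟩
    simp only [faces, Finset.mem_filter, mem_trianglePoints] at h
    ext <;> simp only
    omega

theorem det_faceMatrix_squarePoints (m : ℕ) :
    (faceMatrix (squarePoints (m + 1))).det = (kroneckerSum (pathDirichlet m)).det := by
  rw [← det_submatrix_equiv_self (facesSquareEquiv m)]
  congr 1
  ext ⟨a, b⟩ ⟨c, d⟩
  simp only [faceMatrix, facesSquareEquiv, kroneckerSum, pathDirichlet, submatrix_apply, of_apply,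
    Equiv.coe_fn_mk, Matrix.add_apply, kroneckerMap_apply, Matrix.one_apply, Subtype.mk.injEq,
    Prod.mk.injEq, Fin.ext_iff]
  grind

/-- Faces on different sides of the diagonal are not adjacent, so the correction by the swapped
pair vanishes in the antisymmetric part. -/
theorem det_faceMatrix_trianglePoints (m : ℕ) :
    (faceMatrix (trianglePoints (m + 1))).det =
      (antisymmetricPart (kroneckerSum (pathDirichlet m))).det := by
  rw [← det_submatrix_equiv_self (facesTriangleEquiv m)]
  congr 1
  ext ⟨⟨a, b⟩, h⟩ ⟨⟨c, d⟩, h'⟩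
  simp only [Fin.lt_def] at h h'
  have hb := b.2
  have hd := d.2
  simp only [faceMatrix, facesTriangleEquiv, antisymmetricPart, kroneckerSum, pathDirichlet,
    submatrix_apply, of_apply, Equiv.coe_fn_mk, Matrix.add_apply, kroneckerMap_apply,
    Matrix.one_apply, Subtype.mk.injEq, Prod.mk.injEq, Fin.ext_iff, Prod.swap_prod_mk]
  grind

theorem numSpanningTrees_rectLattice_eq (m : ℕ) :
    (numSpanningTrees (rectLattice (m + 1) (m + 1)) : ℝ) =
      2 ^ m * (m + 1) * (numSpanningTrees (quarteredAztecDiamond (m + 1)) : ℝ) ^ 2 := by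
  rw [numSpanningTrees_congr (rectLatticeIso (m + 1)),
    numSpanningTrees_congr (quarteredAztecDiamondIso (m + 1)),
    numSpanningTrees_latticeGraph (isLowerSet_squarePoints _)
      ⟨(0, 0), mem_squarePoints.mpr ⟨Nat.succ_pos _, Nat.succ_pos _⟩⟩,
    numSpanningTrees_latticeGraph (isLowerSet_trianglePoints _)
      ⟨(0, 0), mem_trianglePoints.mpr (Nat.succ_pos _)⟩,
    det_faceMatrix_squarePoints, det_faceMatrix_trianglePoints,
    det_kroneckerSum _ (pathDirichlet_isHermitian m), det_pathDirichlet, Fintype.card_fin]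

theorem mainTheorem4 (n : ℕ) (hn : 1 ≤ n) :
    (numSpanningTrees (quarteredAztecDiamond n) : ℝ) =
      √(numSpanningTrees (rectLattice n n) : ℝ) /
        (√(n : ℝ) * (2 : ℝ) ^ (((n : ℝ) - 1) / 2)) := by
  obtain ⟨m, rfl⟩ : ∃ m, n = m + 1 := ⟨n - 1, by omega⟩
  have hpow : (2 : ℝ) ^ ((((m + 1 : ℕ) : ℝ) - 1) / 2) = √(2 ^ m) := by
    rw [Real.sqrt_eq_rpow, ← Real.rpow_natCast_mul (by norm_num)]
    congr 1
    push_cast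
    ring
  rw [numSpanningTrees_rectLattice_eq, Real.sqrt_mul (by positivity),
    Real.sqrt_sq (Nat.cast_nonneg _), Real.sqrt_mul (by positivity), hpow,
    mul_comm (√(2 ^ m)), Nat.cast_add, Nat.cast_one, mul_div_cancel_left₀]
  positivity
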